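/- Let $\mathcal L=\mathbb Z^2$. A labeled configuration is a function $C\colon\mathcal L\to\Sigma\cup\{\mathrm{empty}\}$, where $\Sigma$ is any set of labels, such that only finitely many positions are full (i.e. not mapped to empty). Each full position carries one token. The bounding box of $C$ is the smallest axis-parallel rectangle containing all full positions. A push to the left acts as follows: going through the columns of the bounding box from left to right, starting with the second one, each token of the current column whose left neighbour cell is empty at that moment is moved one unit to the left. Pushes to the right, up and down are defined symmetrically. Configurations are identified when they differ by a translation. A configuration is canonical if the left push and the down push both leave it unchanged, up to translation. Let $G_C$ be the set of all permutations $\pi$ of the tokens of $C$ (each token being named by the position it occupies in $C$) for which there are a finite sequence of pushes and a translation vector $v$ such that this sequence, applied to $C$, ends in a configuration whose set of full positions is that of $C$ translated by $v$, and in which the token that started at position $t$ ends at position $\pi(t)+v$, for every token $t$ of $C$. **Theorem.** Let $C$ be a labeled canonical configuration, and let $\pi\in G_C$. Then $\pi$ is an even permutation. -/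

import Mathlib

namespace PushPuzzle

/-- A labeled configuration on the square lattice, with label set `S`: every lattice position
carries a label or is empty (`none`), and only finitely many positions are full. -/
@[ext]
structure Config (S : Type*) where
  cell : ℤ × ℤ → Option S
  finite_full : {p | cell p ≠ none}.Finite

/-- The four push directions. A push in a direction makes the tokens fall in that direction. -/
inductive Dir
  | left | right | up | down

/-- The unit step in a direction. -/
def Dir.vec : Dir → ℤ × ℤ
  | .left => (-1, 0)
  | .right => (1, 0)
  | .up => (0, 1)
  | .down => (0, -1)

namespace Config

variable {S : Type*}

/-- The set of full positions. -/
def full (C : Config S) : Set (ℤ × ℤ) := {p | C.cell p ≠ none}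

/-- The smallest rectangle that contains all full positions. -/
def boundingBox (C : Config S) : Set (ℤ × ℤ) :=
  {p | (∃ a ∈ C.full, a.1 ≤ p.1) ∧ (∃ b ∈ C.full, p.1 ≤ b.1) ∧
       (∃ c ∈ C.full, c.2 ≤ p.2) ∧ (∃ d ∈ C.full, p.2 ≤ d.2)}

/-- `C.Falls d p`: the token at `p` moves by one unit when `C` is pushed in direction `d`.
The lines orthogonal to `d` are processed in order, starting from the side of the bounding box
towards which the tokens fall; a token moves if the next cell lies in the bounding box and is
empty, either from the start or because its token has just moved away. -/
inductive Falls (C : Config S) (d : Dir) : ℤ × ℤ → Prop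
  | gap (p : ℤ × ℤ) : p ∈ C.full → p + d.vec ∈ C.boundingBox → p + d.vec ∉ C.full → Falls C d p
  | follow (p : ℤ × ℤ) : p ∈ C.full → Falls C d (p + d.vec) → Falls C d p

open Classical in
/-- The push of `C` in direction `d`: all tokens that can move fall by one unit. -/
noncomputable def push (C : Config S) (d : Dir) : Config S where
  cell q := if C.Falls d (q - d.vec) then C.cell (q - d.vec)
    else if C.Falls d q then none else C.cell q
  finite_full := by
    refine (C.finite_full.union (C.finite_full.image (· + d.vec))).subset ?_
    intro q hq
    simp only [Set.mem_ofPred_eq] at hq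
    split_ifs at hq with h1 h2
    · exact Or.inr ⟨q - d.vec, hq, by simp⟩
    · exact absurd rfl hq
    · exact Or.inl hq

/-- The result of a finite sequence of pushes. -/
noncomputable def pushes (C : Config S) (ds : List Dir) : Config S := ds.foldl push C

/-- Equality of configurations up to translation. -/
def Equivalent (C C' : Config S) : Prop := ∃ v : ℤ × ℤ, ∀ p, C'.cell (p + v) = C.cell p

/-- A configuration is canonical if a left push and a down push both leave it unchanged, up to
translation. -/
def IsCanonical (C : Config S) : Prop :=
  Equivalent C (C.push .left) ∧ Equivalent C (C.push .down)

/-- The tokens of `C`, each named by the position that it occupies in `C`. -/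
abbrev Token (C : Config S) : Type := {p : ℤ × ℤ // p ∈ C.full}

noncomputable instance (C : Config S) : Fintype C.Token := C.finite_full.fintype

open Classical in
/-- The configuration `C` with every label replaced by the identity of the token. Pushes do not
look at labels, so pushing `C.tracked` records where each token of `C` goes. -/
noncomputable def tracked (C : Config S) : Config C.Token where
  cell p := if h : p ∈ C.full then some ⟨p, h⟩ else none
  finite_full := by
    refine C.finite_full.subset ?_
    intro p hp
    by_contra h
    exact hp (dif_neg h)

/-- The set `G_C` of the permutations `π` of the tokens of `C` that result from a sequence of
pushes leading back to the shape of `C`, up to a translation `v`: the token that starts at `t`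
ends at the place `π t`. -/
def permGroup (C : Config S) : Set (Equiv.Perm C.Token) :=
  {π | ∃ (ds : List Dir) (v : ℤ × ℤ),
    (C.tracked.pushes ds).full = (· + v) '' C.full ∧
    ∀ t : C.Token, (C.tracked.pushes ds).cell ((π t : ℤ × ℤ) + v) = some t}

end Config

end PushPuzzle

/-! The full set of a canonical configuration is nested: any two of its rows are comparable under
inclusion. A push of a nested set acts on the set (not on the tokens) as a permutation of the lines
orthogonal to the push (`exists_perm_full_push`), so nestedness survives every push.

Order the tokens by their starting places, row by row, and count mod 2 the inversions of their
current places in the row order and in the column order. A pair is inverted by exactly one of the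
two orders when its two positions are ordered differently by rows and columns, so the sum of both
counts is `crossings`, which depends only on the full set (`inversions_row_add_col`). Exchanging
rows `P ⊆ Q` changes `crossings` by `#P * (#Q - 1)`, and `lengthParity` is built to cancel this.

Hence row inversions plus `lengthParity` is invariant. A horizontal push preserves the row order and
all row lengths; a vertical one preserves the column order and `crossings + lengthParity`. When the
tokens return to the original places up to translation, `lengthParity` is back at its first value,
so the permutation has evenly many inversions. -/

namespace PushPuzzle

/-! ### Lines orthogonal to a direction, and nested sets -/

/-- The rank of the line orthogonal to `d` through a position, increasing in direction `d`. -/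
def Dir.rank : Dir → ℤ × ℤ → ℤ
  | .left, p => -p.1
  | .right, p => p.1
  | .up, p => p.2
  | .down, p => -p.2

/-- The permutation `σ` acting on the lines orthogonal to `d`. -/
def Dir.act (σ : Equiv.Perm ℤ) : Dir → ℤ × ℤ → ℤ × ℤ
  | .left, p => (σ p.1, p.2)
  | .right, p => (σ p.1, p.2)
  | .up, p => (p.1, σ p.2)
  | .down, p => (p.1, σ p.2)

theorem Dir.rank_add (d : Dir) (p q : ℤ × ℤ) : d.rank (p + q) = d.rank p + d.rank q := by
  cases d <;> simp [Dir.rank] <;> ring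

@[simp] theorem Dir.rank_vec (d : Dir) : d.rank d.vec = 1 := by
  cases d <;> rfl

@[simp] theorem Dir.rank_add_vec (d : Dir) (p : ℤ × ℤ) : d.rank (p + d.vec) = d.rank p + 1 := by
  rw [Dir.rank_add, Dir.rank_vec]

@[simp] theorem Dir.rank_sub_vec (d : Dir) (p : ℤ × ℤ) : d.rank (p - d.vec) = d.rank p - 1 := by
  have := d.rank_add_vec (p - d.vec)
  rw [sub_add_cancel] at this
  omega

@[simp] theorem Dir.act_one (d : Dir) (p : ℤ × ℤ) : d.act 1 p = p := by
  cases d <;> rfl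

theorem Dir.act_mul (d : Dir) (σ τ : Equiv.Perm ℤ) (p : ℤ × ℤ) :
    d.act (σ * τ) p = d.act σ (d.act τ p) := by
  cases d <;> rfl

/-- The exchange of two neighbouring lines, as a permutation of the lines. -/
theorem Dir.exists_act_eq_swap (d : Dir) (k : ℤ) : ∃ σ : Equiv.Perm ℤ, ∀ q,
    (d.rank q = k → d.act σ q = q + d.vec) ∧ (d.rank q = k + 1 → d.act σ q = q - d.vec) ∧
    (d.rank q ≠ k → d.rank q ≠ k + 1 → d.act σ q = q) := by
  cases d
  -- Ranks are negated coordinates for `left` and `down`, so the lines of rank `k` and `k + 1` have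
  -- coordinates `-k` and `-k - 1`.
  · refine ⟨Equiv.swap (-k) (-k - 1), fun ⟨x, y⟩ => ?_⟩
    simp only [Dir.rank, Dir.act, Dir.vec, Equiv.swap_apply_def, Prod.ext_iff, Prod.fst_add,
      Prod.snd_add, Prod.fst_sub, Prod.snd_sub]
    refine ⟨fun h => ?_, fun h => ?_, fun h h' => ?_⟩ <;> split_ifs <;>
      (try constructor) <;> first | rfl | omega | simp
  · refine ⟨Equiv.swap k (k + 1), fun ⟨x, y⟩ => ?_⟩
    simp only [Dir.rank, Dir.act, Dir.vec, Equiv.swap_apply_def, Prod.ext_iff, Prod.fst_add,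
      Prod.snd_add, Prod.fst_sub, Prod.snd_sub]
    refine ⟨fun h => ?_, fun h => ?_, fun h h' => ?_⟩ <;> split_ifs <;>
      (try constructor) <;> first | rfl | omega | simp
  · refine ⟨Equiv.swap k (k + 1), fun ⟨x, y⟩ => ?_⟩
    simp only [Dir.rank, Dir.act, Dir.vec, Equiv.swap_apply_def, Prod.ext_iff, Prod.fst_add,
      Prod.snd_add, Prod.fst_sub, Prod.snd_sub]
    refine ⟨fun h => ?_, fun h => ?_, fun h h' => ?_⟩ <;> split_ifs <;>
      (try constructor) <;> first | rfl | omega | simp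
  · refine ⟨Equiv.swap (-k) (-k - 1), fun ⟨x, y⟩ => ?_⟩
    simp only [Dir.rank, Dir.act, Dir.vec, Equiv.swap_apply_def, Prod.ext_iff, Prod.fst_add,
      Prod.snd_add, Prod.fst_sub, Prod.snd_sub]
    refine ⟨fun h => ?_, fun h => ?_, fun h h' => ?_⟩ <;> split_ifs <;>
      (try constructor) <;> first | rfl | omega | simp

/-- A set of positions is nested if any two of its rows (equivalently, columns) are comparable
with respect to inclusion. -/
def Nested (A : Set (ℤ × ℤ)) : Prop :=
  ∀ p ∈ A, ∀ q ∈ A, (p.1, q.2) ∈ A ∨ (q.1, p.2) ∈ A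

theorem Nested.of_act {A B : Set (ℤ × ℤ)} (hA : Nested A) (d : Dir) (σ : Equiv.Perm ℤ)
    (h : ∀ q, q ∈ B ↔ d.act σ q ∈ A) : Nested B := by
  intro p hp q hq
  rw [h] at hp hq ⊢
  rw [h]
  cases d <;> exact hA _ hp _ hq

theorem Nested.add_vec_mem_or {A : Set (ℤ × ℤ)} (hA : Nested A) {d : Dir} {p q : ℤ × ℤ}
    (hp : p ∈ A) (hq : q ∈ A) (h : d.rank q = d.rank p + 1) :
    p + d.vec ∈ A ∨ q - d.vec ∈ A := by
  obtain ⟨x, y⟩ := p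
  obtain ⟨z, w⟩ := q
  cases d
  · obtain rfl : z = x - 1 := by simp only [Dir.rank] at h; omega
    simpa [Dir.vec, sub_eq_add_neg, or_comm] using hA _ hp _ hq
  · obtain rfl : z = x + 1 := by simp only [Dir.rank] at h; omega
    simpa [Dir.vec, sub_eq_add_neg, or_comm] using hA _ hp _ hq
  · obtain rfl : w = y + 1 := by simp only [Dir.rank] at h; omega
    simpa [Dir.vec, sub_eq_add_neg] using hA _ hp _ hq
  · obtain rfl : w = y - 1 := by simp only [Dir.rank] at h; omega
    simpa [Dir.vec, sub_eq_add_neg] using hA _ hp _ hq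

/-! ### Pushes as permutations of lines -/

namespace Config

variable {S : Type*}

theorem exists_rank_le {C : Config S} {p : ℤ × ℤ} (d : Dir) (hp : p ∈ C.boundingBox) :
    ∃ a ∈ C.full, d.rank p ≤ d.rank a := by
  obtain ⟨⟨a, ha, ha'⟩, ⟨b, hb, hb'⟩, ⟨c, hc, hc'⟩, ⟨e, he, he'⟩⟩ := hp
  cases d
  · exact ⟨a, ha, by simpa [Dir.rank] using ha'⟩
  · exact ⟨b, hb, hb'⟩
  · exact ⟨e, he, he'⟩
  · exact ⟨c, hc, by simpa [Dir.rank] using hc'⟩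

theorem add_vec_mem_boundingBox {C : Config S} {d : Dir} {p a : ℤ × ℤ} (hp : p ∈ C.full)
    (ha : a ∈ C.full) (h : d.rank p < d.rank a) : p + d.vec ∈ C.boundingBox := by
  cases d <;> simp only [Dir.rank] at h <;> refine ⟨?_, ?_, ?_, ?_⟩ <;>
    simp only [Dir.vec, Prod.fst_add, Prod.snd_add] <;>
    first
      | exact ⟨p, hp, by omega⟩
      | exact ⟨a, ha, by omega⟩

theorem mem_boundingBox_of_mem_full {C : Config S} {p : ℤ × ℤ} (hp : p ∈ C.full) :
    p ∈ C.boundingBox :=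
  ⟨⟨p, hp, le_rfl⟩, ⟨p, hp, le_rfl⟩, ⟨p, hp, le_rfl⟩, ⟨p, hp, le_rfl⟩⟩

namespace Falls

variable {C : Config S} {d : Dir} {p : ℤ × ℤ}

theorem mem_full (h : C.Falls d p) : p ∈ C.full := by
  cases h <;> assumption

theorem add_vec_mem_boundingBox (h : C.Falls d p) : p + d.vec ∈ C.boundingBox := by
  cases h with
  | gap _ _ h _ => exact h
  | follow _ _ h => exact mem_boundingBox_of_mem_full h.mem_full

theorem add_vec (h : C.Falls d p) (h' : p + d.vec ∈ C.full) : C.Falls d (p + d.vec) := by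
  cases h with
  | gap _ _ _ h => exact absurd h' h
  | follow _ _ h => exact h

end Falls

theorem falls_iff {C : Config S} {d : Dir} {p : ℤ × ℤ} : C.Falls d p ↔
    p ∈ C.full ∧ p + d.vec ∈ C.boundingBox ∧ ¬(p + d.vec ∈ C.full ∧ ¬C.Falls d (p + d.vec)) := by
  refine ⟨fun h => ⟨h.mem_full, h.add_vec_mem_boundingBox, fun h' => h'.2 (h.add_vec h'.1)⟩,
    fun ⟨h, h', h''⟩ => ?_⟩
  by_cases hf : p + d.vec ∈ C.full
  · exact .follow _ h (not_not.1 fun hn => h'' ⟨hf, hn⟩)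
  · exact .gap _ h h' hf

/-- The set of full positions after the lines of rank at least `k` have been processed. -/
def partialFull (C : Config S) (d : Dir) (k : ℤ) : Set (ℤ × ℤ) :=
  {q | (C.Falls d (q - d.vec) ∧ k ≤ d.rank q - 1) ∨ (q ∈ C.full ∧ ¬(C.Falls d q ∧ k ≤ d.rank q))}

/-- If some token of line `k` falls, its next cell is an empty cell of line `k + 1`, so nestedness
forces line `k + 1` to be contained in line `k`. The tokens that stay are then those facing a full
cell: line `k` takes the old pattern of line `k + 1` and vice versa. If no token falls, the identity
works. -/
theorem exists_perm_partialFull_step {C : Config S} {d : Dir} {k : ℤ}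
    (hA : Nested (C.partialFull d (k + 1))) : ∃ σ : Equiv.Perm ℤ, ∀ q,
      q ∈ C.partialFull d k ↔ d.act σ q ∈ C.partialFull d (k + 1) := by
  have low : ∀ q, d.rank q = k → (q ∈ C.partialFull d (k + 1) ↔ q ∈ C.full) := by
    intro q hq
    simp [partialFull, hq]
  have high : ∀ q, d.rank q = k + 1 →
      (q ∈ C.partialFull d (k + 1) ↔ q ∈ C.full ∧ ¬C.Falls d q) := by
    intro q hq
    simp [partialFull, hq]
  have other : ∀ q, d.rank q ≠ k → d.rank q ≠ k + 1 →
      (q ∈ C.partialFull d k ↔ q ∈ C.partialFull d (k + 1)) := by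
    intro q h1 h2
    have e1 : k ≤ d.rank q - 1 ↔ k + 1 ≤ d.rank q - 1 := by omega
    have e2 : k ≤ d.rank q ↔ k + 1 ≤ d.rank q := by omega
    simp only [partialFull, Set.mem_ofPred_eq, e1, e2]
  have low' : ∀ q, d.rank q = k → (q ∈ C.partialFull d k ↔ q ∈ C.full ∧ ¬C.Falls d q) := by
    intro q hq
    simp [partialFull, hq]
  have high' : ∀ q, d.rank q = k + 1 → (q ∈ C.partialFull d k ↔
      C.Falls d (q - d.vec) ∨ q ∈ C.partialFull d (k + 1)) := by
    intro q hq
    rw [high q hq]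
    simp [partialFull, hq]
  have falls : ∀ q, d.rank q = k → (C.Falls d q ↔ q ∈ C.partialFull d (k + 1) ∧
      q + d.vec ∈ C.boundingBox ∧ q + d.vec ∉ C.partialFull d (k + 1)) := by
    intro q hq
    rw [low q hq, high _ (by simp [hq]), ← falls_iff]
  by_cases hstay : ∀ q, d.rank q = k → ¬C.Falls d q
  · refine ⟨1, fun q => ?_⟩
    rw [Dir.act_one]
    by_cases h1 : d.rank q = k
    · simp [low' q h1, low q h1, hstay q h1]
    by_cases h2 : d.rank q = k + 1
    · simp [high' q h2, hstay (q - d.vec) (by simp [h2])]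
    exact other q h1 h2
  · push Not at hstay
    obtain ⟨p, hpk, hp⟩ := hstay
    obtain ⟨a, ha, hpa⟩ := exists_rank_le d hp.add_vec_mem_boundingBox
    obtain ⟨hpA, -, hpA'⟩ := (falls p hpk).1 hp
    rw [Dir.rank_add_vec] at hpa
    have box : ∀ q, d.rank q = k → q ∈ C.partialFull d (k + 1) → q + d.vec ∈ C.boundingBox := by
      intro q hq hqA
      exact Config.add_vec_mem_boundingBox ((low q hq).1 hqA) ha (by omega)
    have sub : ∀ q, d.rank q = k + 1 → q ∈ C.partialFull d (k + 1) →
        q - d.vec ∈ C.partialFull d (k + 1) := by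
      intro q hq hqA
      exact (hA.add_vec_mem_or hpA hqA (by omega)).resolve_left hpA'
    obtain ⟨σ, hσ⟩ := d.exists_act_eq_swap k
    refine ⟨σ, fun q => ?_⟩
    by_cases h1 : d.rank q = k
    · rw [(hσ q).1 h1, low' q h1, ← low q h1, falls q h1]
      have := sub (q + d.vec) (by simp [h1])
      rw [add_sub_cancel_right] at this
      have := box q h1
      grind
    by_cases h2 : d.rank q = k + 1
    · have h3 : d.rank (q - d.vec) = k := by simp [h2]
      rw [(hσ q).2.1 h2, high' q h2, falls _ h3]
      have h4 := sub q h2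
      have h5 := box _ h3
      rw [sub_add_cancel] at h5 ⊢
      grind
    rw [(hσ q).2.2 h1 h2]
    exact other q h1 h2

theorem mem_full_push {C : Config S} {d : Dir} {q : ℤ × ℤ} : q ∈ (C.push d).full ↔
    C.Falls d (q - d.vec) ∨ (q ∈ C.full ∧ ¬C.Falls d q) := by
  have hfull : ∀ p, p ∈ C.full ↔ C.cell p ≠ none := fun _ => Iff.rfl
  rw [hfull]
  simp only [full, push, Set.mem_ofPred_eq]
  split_ifs with h1 h2
  · simpa [h1] using (hfull _).1 h1.mem_full
  · simp [h1, h2]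
  · simp [h1, h2]

/-- A push of a nested configuration permutes the lines orthogonal to its direction. -/
theorem exists_perm_full_push {C : Config S} (hC : Nested C.full) (d : Dir) :
    ∃ σ : Equiv.Perm ℤ, ∀ q, q ∈ (C.push d).full ↔ d.act σ q ∈ C.full := by
  have hfin : (d.rank '' C.full).Finite := C.finite_full.image _
  obtain ⟨u, hu⟩ := hfin.bddAbove
  obtain ⟨l, hl⟩ := hfin.bddBelow
  have hu' : ∀ p, C.Falls d p → d.rank p ≤ u := fun p hp => hu ⟨p, hp.mem_full, rfl⟩
  have hl' : ∀ p, C.Falls d p → l ≤ d.rank p := fun p hp => hl ⟨p, hp.mem_full, rfl⟩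
  -- Lines are processed by decreasing rank. At threshold `u + 1` nothing has moved yet; each step
  -- is the identity or an exchange of two neighbouring lines.
  have key : ∀ n : ℕ, ∃ σ : Equiv.Perm ℤ, ∀ q,
      q ∈ C.partialFull d (u + 1 - n) ↔ d.act σ q ∈ C.full := by
    intro n
    induction n with
    | zero =>
      refine ⟨1, fun q => ?_⟩
      have h1 : ¬(C.Falls d (q - d.vec) ∧ u + 1 ≤ d.rank q - 1) := fun h => by
        have := hu' _ h.1
        rw [Dir.rank_sub_vec] at this
        omega
      have h2 : ¬(C.Falls d q ∧ u + 1 ≤ d.rank q) := fun h => by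
        have := hu' _ h.1
        omega
      simp only [partialFull, Set.mem_ofPred_eq, Nat.cast_zero, sub_zero, h1, h2, Dir.act_one,
        false_or, not_false_eq_true, and_true]
    | succ n ih =>
      obtain ⟨σ, hσ⟩ := ih
      have e : u + 1 - ((n + 1 : ℕ) : ℤ) + 1 = u + 1 - n := by push_cast; ring
      obtain ⟨τ, hτ⟩ := exists_perm_partialFull_step (C := C) (d := d)
        (k := u + 1 - ((n + 1 : ℕ) : ℤ)) (by rw [e]; exact hC.of_act d σ hσ)
      refine ⟨σ * τ, fun q => ?_⟩
      rw [hτ, e, hσ, Dir.act_mul]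
  -- This many steps bring the threshold down to at most `l`, even if `toNat` truncates, so every
  -- falling token has been processed.
  obtain ⟨σ, hσ⟩ := key (u + 1 - l).toNat
  refine ⟨σ, fun q => ?_⟩
  rw [← hσ, mem_full_push]
  have h1 : C.Falls d (q - d.vec) → u + 1 - (u + 1 - l).toNat ≤ d.rank q - 1 := fun h => by
    have := hl' _ h
    rw [Dir.rank_sub_vec] at this
    omega
  have h2 : C.Falls d q → u + 1 - (u + 1 - l).toNat ≤ d.rank q := fun h => by
    have := hl' _ h
    omega
  simp only [partialFull, Set.mem_ofPred_eq]
  tauto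

theorem nested_full_push {C : Config S} (hC : Nested C.full) (d : Dir) :
    Nested (C.push d).full := by
  obtain ⟨σ, hσ⟩ := exists_perm_full_push hC d
  exact hC.of_act d σ hσ

/-! ### Motion of single tokens; canonical configurations are nested -/

open Classical in
/-- The place to which a push moves the token at a given position. -/
noncomputable def dest (C : Config S) (d : Dir) (p : ℤ × ℤ) : ℤ × ℤ :=
  if C.Falls d p then p + d.vec else p

/-- The case split mirrors the definition of `push`, which computes the content of a cell from its
possible sources. -/
theorem dest_eq_iff {C : Config S} {d : Dir} {p q : ℤ × ℤ} (hp : p ∈ C.full) :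
    C.dest d p = q ↔ (C.Falls d (q - d.vec) ∧ p = q - d.vec) ∨
      (¬C.Falls d (q - d.vec) ∧ ¬C.Falls d q ∧ p = q) := by
  unfold dest
  split_ifs with h
  · constructor
    · rintro rfl
      simp [h]
    · rintro (⟨-, rfl⟩ | ⟨-, h', rfl⟩)
      · simp
      · exact absurd h h'
  · constructor
    · rintro rfl
      refine .inr ⟨fun h' => h ?_, h, rfl⟩
      have := h'.add_vec (by rwa [sub_add_cancel])
      rwa [sub_add_cancel] at this
    · rintro (⟨h', rfl⟩ | ⟨-, -, rfl⟩)
      · exact absurd h' h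
      · rfl

theorem dest_injOn (C : Config S) (d : Dir) : Set.InjOn (C.dest d) C.full := by
  intro p hp q hq h
  rw [dest_eq_iff hp] at h
  have h' := (dest_eq_iff hq).1 (rfl : C.dest d q = C.dest d q)
  rcases h with ⟨h1, h2⟩ | ⟨h1, h2, h3⟩ <;> rcases h' with ⟨h4, h5⟩ | ⟨h4, h5, h6⟩ <;>
    grind

theorem full_push (C : Config S) (d : Dir) : (C.push d).full = C.dest d '' C.full := by
  ext q
  rw [mem_full_push, Set.mem_image]
  constructor
  · rintro (h | ⟨h, h'⟩)
    · exact ⟨q - d.vec, h.mem_full, by simp [dest, h]⟩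
    · exact ⟨q, h, by simp [dest, h']⟩
  · rintro ⟨p, hp, rfl⟩
    unfold dest
    split_ifs with h
    · exact .inl (by simpa using h)
    · exact .inr ⟨hp, h⟩

theorem rank_dest (C : Config S) (d : Dir) (p : ℤ × ℤ) [Decidable (C.Falls d p)] :
    d.rank (C.dest d p) = d.rank p + if C.Falls d p then 1 else 0 := by
  unfold dest
  split_ifs <;> simp

/-- A configuration that a push leaves unchanged up to translation has no falling tokens. -/
theorem not_falls_of_equivalent_push {C : Config S} {d : Dir} (h : Equivalent C (C.push d))
    (p : ℤ × ℤ) : ¬C.Falls d p := by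
  classical
  intro hp
  obtain ⟨v, hv⟩ := h
  have hfull : (C.push d).full = (· + v) '' C.full := by
    ext q
    rw [Set.mem_image]
    constructor
    · intro hq
      refine ⟨q - v, ?_, sub_add_cancel q v⟩
      simpa [full, ← hv (q - v)] using hq
    · rintro ⟨q, hq, rfl⟩
      simpa [full, hv q] using hq
  have hle : ∀ q ∈ C.full, ∃ a ∈ C.full, d.rank (C.dest d q) ≤ d.rank a := by
    intro q hq
    unfold dest
    split_ifs with h
    · exact exists_rank_le d h.add_vec_mem_boundingBox
    · exact ⟨q, hq, le_rfl⟩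
  obtain ⟨m, hm, hmax⟩ := Set.exists_max_image C.full d.rank C.finite_full ⟨p, hp.mem_full⟩
  -- A push never leaves the bounding box, so the largest rank cannot grow.
  have hm0 : d.rank v ≤ 0 := by
    have : m + v ∈ C.dest d '' C.full := by
      rw [← full_push, hfull]
      exact ⟨m, hm, rfl⟩
    obtain ⟨q, hq, hqm⟩ := this
    obtain ⟨a, ha, hqa⟩ := hle q hq
    have := hmax a ha
    rw [hqm, Dir.rank_add] at hqa
    omega
  set A : Finset (ℤ × ℤ) := C.finite_full.toFinset with hA
  have memA : ∀ q, q ∈ A ↔ q ∈ C.full := fun q => C.finite_full.mem_toFinset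
  have himage : A.image (C.dest d) = A.image (· + v) := by
    apply Finset.coe_injective
    rw [Finset.coe_image, Finset.coe_image, hA, Set.Finite.coe_toFinset]
    exact (full_push C d).symm.trans hfull
  -- Compare the total rank: the push raises it by the number of falling tokens, which is positive,
  -- while the translation adds `A.card * d.rank v ≤ 0`.
  have hsum := congrArg (fun B : Finset (ℤ × ℤ) => ∑ q ∈ B, d.rank q) himage
  rw [Finset.sum_image fun x hx y hy => C.dest_injOn d ((memA x).1 hx) ((memA y).1 hy),
    Finset.sum_image (by simp)] at hsum
  simp only [rank_dest, Dir.rank_add, Finset.sum_add_distrib, Finset.sum_const,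
    add_right_inj, nsmul_eq_mul] at hsum
  have hpos : 0 < ∑ q ∈ A, if C.Falls d q then (1 : ℤ) else 0 :=
    Finset.sum_pos' (fun q _ => by split_ifs <;> simp)
      ⟨p, (memA p).2 hp.mem_full, by simp [hp]⟩
  have : (A.card : ℤ) * d.rank v ≤ 0 := mul_nonpos_of_nonneg_of_nonpos (by positivity) hm0
  omega

/-- A full cell with an empty left neighbour inside the bounding box would fall to the left. So
every nonempty row is an interval starting at the leftmost column, and such rows are comparable. -/
theorem IsCanonical.nested_full {C : Config S} (hC : C.IsCanonical) : Nested C.full := by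
  have step : ∀ (n : ℕ) (x y : ℤ), (x + n, y) ∈ C.full → (∃ a ∈ C.full, a.1 ≤ x) →
      (x, y) ∈ C.full := by
    intro n
    induction n with
    | zero =>
      intro x y h _
      simpa using h
    | succ n ih =>
      rintro x y h ⟨a, ha, hax⟩
      refine ih x y ?_ ⟨a, ha, hax⟩
      by_contra hn
      refine not_falls_of_equivalent_push hC.1 _ (.gap _ h ?_ ?_)
      · refine Config.add_vec_mem_boundingBox h ha ?_
        simp only [Dir.rank]
        push_cast
        omega
      · convert hn using 2
        simp only [Dir.vec, Nat.cast_add, Nat.cast_one, Prod.mk_add_mk, add_zero, Prod.mk.injEq,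
          and_true]
        ring
  have main : ∀ p ∈ C.full, ∀ q ∈ C.full, p.1 ≤ q.1 → (p.1, q.2) ∈ C.full := by
    intro p hp q hq h
    refine step (q.1 - p.1).toNat _ _ ?_ ⟨p, hp, le_rfl⟩
    rw [Int.toNat_of_nonneg (by omega), add_sub_cancel]
    exact hq
  intro p hp q hq
  rcases le_total p.1 q.1 with h | h
  · exact .inl (main p hp q hq h)
  · exact .inr (main q hq p hp h)

end Config

end PushPuzzle

/-! ### Signs and sums over pairs -/

open Finset

/-- A permutation with an even number of inversions is even. -/
theorem Equiv.Perm.sign_eq_one_of_inversions {T : Type*} [Fintype T] [LinearOrder T]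
    [DecidableEq T] (π : Equiv.Perm T)
    (h : ∑ t, ∑ u, (if t < u ∧ π u < π t then 1 else 0 : ZMod 2) = 0) : π.sign = 1 := by
  let e : Fin (Fintype.card T) ≃o T := Fintype.orderIsoFinOfCardEq T rfl
  rw [← Equiv.Perm.sign_permCongr e.symm.toEquiv π, Equiv.Perm.sign_eq_prod_prod_Ioi]
  have hprod : ∏ i, ∏ j ∈ Finset.Ioi i,
      (if e.symm.toEquiv.permCongr π i < e.symm.toEquiv.permCongr π j then 1 else -1 : ℤˣ) =
      ∏ t : T, ∏ u : T, (-1 : ℤˣ) ^ (if t < u ∧ π u < π t then 1 else 0) := by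
    refine Fintype.prod_equiv e.toEquiv _ _ fun i => ?_
    rw [← Fintype.prod_equiv e.toEquiv _ _ fun j => rfl]
    rw [← Finset.prod_filter_mul_prod_filter_not univ (fun j => i < j)]
    have h1 : ∏ j with ¬i < j, (-1 : ℤˣ) ^
        (if e.toEquiv i < e.toEquiv j ∧ π (e.toEquiv j) < π (e.toEquiv i) then 1 else 0) = 1 := by
      refine Finset.prod_eq_one fun j hj => ?_
      rw [if_neg, pow_zero]
      have := (Finset.mem_filter.1 hj).2
      simpa using fun h => absurd h this
    rw [h1, mul_one]
    refine Finset.prod_congr (by ext; simp) fun j hj => ?_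
    have hij : i < j := by simpa using hj
    have hne : π (e i) ≠ π (e j) := by simpa using hij.ne
    rcases lt_or_gt_of_ne hne with h | h
    · simp [Equiv.permCongr_apply, h, h.le]
    · simp [Equiv.permCongr_apply, h, h.le, hij]
  rw [hprod]
  simp_rw [Finset.prod_pow_eq_pow_sum]
  apply Even.neg_one_pow
  rw [← ZMod.natCast_eq_zero_iff_even]
  push_cast
  exact h

/-- A symmetric weight is a function of unordered pairs, so it does not matter which linear order
selects one representative of each pair. -/
theorem Finset.sum_sum_ite_lt_of_symm {M : Type*} [AddCommMonoid M] (Y : Finset ℤ) {κ : ℤ → ℤ}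
    (hκ : Function.Injective κ) (w : ℤ → ℤ → M) (hw : ∀ a b, w a b = w b a) :
    ∑ a ∈ Y, ∑ b ∈ Y, (if κ a < κ b then w a b else 0) =
      ∑ a ∈ Y, ∑ b ∈ Y, (if a < b then w a b else 0) := by
  have h1 : ∑ a ∈ Y, ∑ b ∈ Y, (if κ a < κ b then w a b else 0) =
      ∑ a ∈ Y, ∑ b ∈ Y, (if κ a < κ b ∧ a < b then w a b else 0) +
      ∑ a ∈ Y, ∑ b ∈ Y, (if κ a < κ b ∧ b < a then w a b else 0) := by
    simp_rw [← Finset.sum_add_distrib]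
    refine Finset.sum_congr rfl fun a _ => Finset.sum_congr rfl fun b _ => ?_
    rcases lt_trichotomy a b with h | rfl | h
    · simp [h, h.not_gt]
    · simp
    · simp [h, h.not_gt]
  have h2 : ∑ a ∈ Y, ∑ b ∈ Y, (if a < b then w a b else 0) =
      ∑ a ∈ Y, ∑ b ∈ Y, (if κ a < κ b ∧ a < b then w a b else 0) +
      ∑ a ∈ Y, ∑ b ∈ Y, (if κ b < κ a ∧ a < b then w b a else 0) := by
    simp_rw [← Finset.sum_add_distrib]
    refine Finset.sum_congr rfl fun a _ => Finset.sum_congr rfl fun b _ => ?_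
    rcases lt_trichotomy (κ a) (κ b) with h | h | h
    · simp [h, h.not_gt]
    · simp [hκ h]
    · simp [h, h.not_gt, hw a b]
  rw [h1, h2]
  congr 1
  rw [Finset.sum_comm]

/-! ### Crossings and their correction by row lengths -/

namespace PushPuzzle

/-- The key of a position in the order by rows. -/
def rowKey (p : ℤ × ℤ) : ℤ ×ₗ ℤ := toLex (p.2, p.1)

/-- The key of a position in the order by columns. -/
def colKey (p : ℤ × ℤ) : ℤ ×ₗ ℤ := toLex p

theorem rowKey_lt {p q : ℤ × ℤ} : rowKey p < rowKey q ↔ p.2 < q.2 ∨ p.2 = q.2 ∧ p.1 < q.1 :=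
  Prod.Lex.lt_iff ..

theorem colKey_lt {p q : ℤ × ℤ} : colKey p < colKey q ↔ p.1 < q.1 ∨ p.1 = q.1 ∧ p.2 < q.2 :=
  Prod.Lex.lt_iff ..

theorem rowKey_injective : Function.Injective rowKey := by
  rintro ⟨a, b⟩ ⟨c, d⟩ h
  have := toLex.injective h
  simp_all

/-- The horizontal coordinates of the positions of `A` in row `y`. -/
def row (A : Finset (ℤ × ℤ)) (y : ℤ) : Finset ℤ := {p ∈ A | p.2 = y}.image Prod.fst

theorem mem_row {A : Finset (ℤ × ℤ)} {x y : ℤ} : x ∈ row A y ↔ (x, y) ∈ A := by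
  simp [row]

theorem sum_eq_sum_row {M : Type*} [AddCommMonoid M] (A : Finset (ℤ × ℤ)) (h : ℤ × ℤ → M) :
    ∑ p ∈ A, h p = ∑ y ∈ A.image Prod.snd, ∑ x ∈ row A y, h (x, y) := by
  rw [← Finset.sum_fiberwise_of_maps_to (g := Prod.snd) (t := A.image Prod.snd)
    fun p hp => Finset.mem_image_of_mem _ hp]
  refine Finset.sum_congr rfl fun y _ => ?_
  rw [row, Finset.sum_image]
  · refine Finset.sum_congr rfl fun p hp => ?_
    rw [← (Finset.mem_filter.1 hp).2]
  · intro p hp q hq h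
    simp only [coe_filter, Set.mem_ofPred_eq] at hp hq
    exact Prod.ext h (hp.2.trans hq.2.symm)

/-- The parity of the number of pairs of positions that rows and columns order differently. -/
def crossings (A : Finset (ℤ × ℤ)) : ZMod 2 :=
  ∑ p ∈ A, ∑ q ∈ A, if p.1 < q.1 ∧ q.2 < p.2 then 1 else 0

/-- The parity of the number of pairs `x < z` with `x ∈ Q` and `z ∈ P`. -/
def rowCrossings (P Q : Finset ℤ) : ZMod 2 := ∑ x ∈ Q, ∑ z ∈ P, if x < z then 1 else 0

/-- The correction term for a row of length `a` below a row of length `b`. -/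
def lengthTerm (a b : ℕ) : ZMod 2 := if a < b then a * (b - 1) else 0

/-- A parity that depends only on the sequence of row lengths. -/
def lengthParity (A : Finset (ℤ × ℤ)) : ZMod 2 :=
  ∑ y ∈ A.image Prod.snd, ∑ z ∈ A.image Prod.snd,
    if y < z then lengthTerm #(row A y) #(row A z) else 0

theorem crossings_eq (A : Finset (ℤ × ℤ)) : crossings A =
    ∑ y ∈ A.image Prod.snd, ∑ z ∈ A.image Prod.snd,
      if y < z then rowCrossings (row A y) (row A z) else 0 := by
  unfold crossings
  rw [sum_eq_sum_row, Finset.sum_comm (s := A.image Prod.snd) (t := A.image Prod.snd)]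
  refine Finset.sum_congr rfl fun z _ => ?_
  rw [Finset.sum_congr rfl fun x _ => sum_eq_sum_row A _, Finset.sum_comm]
  refine Finset.sum_congr rfl fun y _ => ?_
  by_cases h : y < z <;> simp [h, rowCrossings]

/-- By trichotomy each pair in `P × Q` is counted exactly once. -/
theorem rowCrossings_add_swap (P Q : Finset ℤ) :
    rowCrossings P Q + rowCrossings Q P + #(P ∩ Q) = #P * #Q := by
  have h : (#(P ∩ Q) : ZMod 2) = ∑ x ∈ Q, ∑ z ∈ P, if x = z then 1 else 0 := by
    simp [Finset.inter_comm P Q]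
  have h' : (#P * #Q : ZMod 2) = ∑ x ∈ Q, ∑ z ∈ P, 1 := by
    simp [mul_comm]
  rw [h, h', rowCrossings, rowCrossings, Finset.sum_comm (s := P) (t := Q)]
  simp_rw [← Finset.sum_add_distrib]
  refine Finset.sum_congr rfl fun x _ => Finset.sum_congr rfl fun z _ => ?_
  rcases lt_trichotomy x z with h | rfl | h
  · simp [h, h.not_gt, h.ne]
  · simp
  · simp [h, h.not_gt, h.ne']

/-- For `P ⊆ Q` the intersection is `P`, so exchanging the rows costs `#P * #Q - #P` mod 2. The
length term contributes this to only one of the two arrangements; for equal lengths the rows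
coincide and nothing is needed. -/
theorem rowCrossings_add_lengthTerm_comm {P Q : Finset ℤ} (h : P ⊆ Q ∨ Q ⊆ P) :
    rowCrossings P Q + lengthTerm #P #Q = rowCrossings Q P + lengthTerm #Q #P := by
  wlog hPQ : P ⊆ Q generalizing P Q
  · exact (this h.symm (h.resolve_left hPQ)).symm
  have key := rowCrossings_add_swap P Q
  rw [Finset.inter_eq_left.2 hPQ] at key
  have two : (2 : ZMod 2) = 0 := rfl
  rcases (Finset.card_le_card hPQ).lt_or_eq with hlt | heq
  · rw [lengthTerm, lengthTerm, if_pos hlt, if_neg hlt.not_gt]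
    linear_combination key + (#P * #Q - #P - rowCrossings Q P) * two
  · obtain rfl := Finset.eq_of_subset_of_card_le hPQ heq.ge
    rfl

theorem row_subset_or {A : Finset (ℤ × ℤ)} (hA : Nested A) (y z : ℤ) :
    row A y ⊆ row A z ∨ row A z ⊆ row A y := by
  by_contra! h
  obtain ⟨⟨a, ha, ha'⟩, ⟨b, hb, hb'⟩⟩ :=
    And.intro (Finset.not_subset.1 h.1) (Finset.not_subset.1 h.2)
  rw [mem_row] at ha ha' hb hb'
  rcases hA _ ha _ hb with h | h
  · exact ha' h
  · exact hb' h

theorem crossings_add_lengthParity_eq (A : Finset (ℤ × ℤ)) : crossings A + lengthParity A =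
    ∑ y ∈ A.image Prod.snd, ∑ z ∈ A.image Prod.snd, if y < z then
      rowCrossings (row A y) (row A z) + lengthTerm #(row A y) #(row A z) else 0 := by
  rw [crossings_eq, lengthParity]
  simp_rw [← Finset.sum_add_distrib]
  refine Finset.sum_congr rfl fun y _ => Finset.sum_congr rfl fun z _ => ?_
  split_ifs <;> simp

/-- A permutation of the rows of a nested set does not change `crossings + lengthParity`. -/
theorem crossings_add_lengthParity_of_perm {A B : Finset (ℤ × ℤ)} (hA : Nested A)
    (σ : Equiv.Perm ℤ) (h : ∀ q, q ∈ B ↔ (q.1, σ q.2) ∈ A) :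
    crossings B + lengthParity B = crossings A + lengthParity A := by
  have hrow : ∀ y, row B y = row A (σ y) := fun y => by
    ext x
    rw [mem_row, mem_row, h]
  have himage : A.image Prod.snd = (B.image Prod.snd).image σ := by
    ext y
    simp only [Finset.mem_image, Prod.exists, exists_eq_right]
    constructor
    · rintro ⟨x, hx⟩
      exact ⟨σ.symm y, ⟨x, by simpa [h] using hx⟩, by simp⟩
    · rintro ⟨z, ⟨x, hx⟩, rfl⟩
      exact ⟨x, (h _).1 hx⟩
  -- The summand is symmetric in the two rows, so the rows of `A` may be ordered by `σ.symm`, that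
  -- is, as they occur in `B`; reindexing by `σ` then gives the sum for `B`.
  rw [crossings_add_lengthParity_eq, crossings_add_lengthParity_eq,
    ← Finset.sum_sum_ite_lt_of_symm _ σ.symm.injective _
      fun y z => rowCrossings_add_lengthTerm_comm (row_subset_or hA y z), himage,
    Finset.sum_image fun _ _ _ _ h => σ.injective h]
  refine Finset.sum_congr rfl fun y _ => ?_
  rw [Finset.sum_image fun _ _ _ _ h => σ.injective h]
  simp [hrow]

/-! ### Inversions of a placement of tokens -/

section Tokens

variable {T : Type*} [Fintype T]

theorem card_row_image {f : T → ℤ × ℤ} (hf : Function.Injective f) (y : ℤ) :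
    #(row (univ.image f) y) = #{t | (f t).2 = y} := by
  rw [row, Finset.filter_image, Finset.image_image, Finset.card_image_of_injOn]
  intro t ht u hu h
  simp only [coe_filter, mem_univ, true_and, Set.mem_ofPred_eq] at ht hu
  exact hf (Prod.ext h (ht.trans hu.symm))

/-- Moving tokens within their rows, permuting tokens and translating all of them vertically does
not change the row lengths. -/
theorem lengthParity_image_eq {f g : T → ℤ × ℤ} (hf : Function.Injective f)
    (hg : Function.Injective g) (π : Equiv.Perm T) (c : ℤ)
    (h : ∀ t, (g t).2 = (f (π t)).2 + c) :
    lengthParity (univ.image g) = lengthParity (univ.image f) := by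
  have hc : Function.Injective fun y : ℤ => y + c := add_left_injective c
  have himage : (univ.image g).image Prod.snd =
      ((univ.image f).image Prod.snd).image (· + c) := by
    ext y
    simp only [Finset.mem_image, mem_univ, true_and, exists_exists_eq_and, h]
    constructor
    · rintro ⟨t, rfl⟩
      exact ⟨_, rfl⟩
    · rintro ⟨t, rfl⟩
      exact ⟨π.symm t, by simp⟩
  have hcard : ∀ y, #(row (univ.image g) (y + c)) = #(row (univ.image f) y) := by
    intro y
    rw [card_row_image hg, card_row_image hf]
    refine Finset.card_bij (fun t _ => π t) (by simp [h]) (by simp) fun t ht => ?_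
    refine ⟨π.symm t, ?_, by simp⟩
    simpa [h] using ht
  rw [lengthParity, lengthParity, himage, Finset.sum_image fun _ _ _ _ h => hc h]
  refine Finset.sum_congr rfl fun y _ => ?_
  rw [Finset.sum_image fun _ _ _ _ h => hc h]
  simp [hcard]

variable [LinearOrder T]

/-- The parity of the number of inversions of a placement of the tokens. -/
def inversions (key : ℤ × ℤ → ℤ ×ₗ ℤ) (f : T → ℤ × ℤ) : ZMod 2 :=
  ∑ t, ∑ u, if t < u ∧ key (f u) < key (f t) then 1 else 0

/-- Mod 2, a pair inverted by both orders or by neither cancels; what remains are the pairs on which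
the two orders disagree, whatever the order on the tokens. -/
theorem inversions_row_add_col {f : T → ℤ × ℤ} (hf : Function.Injective f) :
    inversions rowKey f + inversions colKey f = crossings (univ.image f) := by
  have h1 : crossings (univ.image f) =
      ∑ t, ∑ u, (if t < u ∧ (f t).1 < (f u).1 ∧ (f u).2 < (f t).2 then (1 : ZMod 2) else 0) +
      ∑ t, ∑ u, (if u < t ∧ (f t).1 < (f u).1 ∧ (f u).2 < (f t).2 then (1 : ZMod 2) else 0) := by
    rw [crossings, Finset.sum_image fun _ _ _ _ h => hf h]
    simp_rw [← Finset.sum_add_distrib]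
    refine Finset.sum_congr rfl fun t _ => ?_
    rw [Finset.sum_image fun _ _ _ _ h => hf h]
    refine Finset.sum_congr rfl fun u _ => ?_
    rcases lt_trichotomy t u with h | rfl | h
    · simp [h, h.not_gt]
    · simp
    · simp [h, h.not_gt]
  rw [h1, Finset.sum_comm (f := fun t u =>
    if u < t ∧ (f t).1 < (f u).1 ∧ (f u).2 < (f t).2 then (1 : ZMod 2) else 0),
    inversions, inversions]
  simp_rw [← Finset.sum_add_distrib]
  refine Finset.sum_congr rfl fun t _ => Finset.sum_congr rfl fun u _ => ?_
  by_cases htu : t < u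
  · have hne : f t ≠ f u := hf.ne htu.ne
    have two : (1 + 1 : ZMod 2) = 0 := rfl
    rw [ne_eq, Prod.ext_iff] at hne
    simp only [htu, true_and, rowKey_lt, colKey_lt]
    rcases lt_trichotomy (f t).1 (f u).1 with h | h | h <;>
      rcases lt_trichotomy (f t).2 (f u).2 with h' | h' | h' <;>
      simp_all [LT.lt.not_gt, LT.lt.ne, LT.lt.ne']
  · simp [htu]

theorem inversions_congr {key : ℤ × ℤ → ℤ ×ₗ ℤ} {f g : T → ℤ × ℤ}
    (h : ∀ t u, key (f t) < key (f u) ↔ key (g t) < key (g u)) :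
    inversions key f = inversions key g := by
  simp [inversions, h]

end Tokens

end PushPuzzle

/-! ### Order preserved by pushes, and the invariant -/

namespace PushPuzzle

/-- Horizontal directions. -/
def Dir.IsHorizontal : Dir → Prop
  | .left => True
  | .right => True
  | .up => False
  | .down => False

namespace Config

section Dest

variable {S : Type*} {C : Config S} {d : Dir} {p q : ℤ × ℤ}

theorem dest_snd (hd : d.IsHorizontal) (p : ℤ × ℤ) : (C.dest d p).2 = p.2 := by
  unfold dest
  cases d <;> first | exact hd.elim | (split_ifs <;> simp [Dir.vec])

theorem dest_fst (hd : ¬d.IsHorizontal) (p : ℤ × ℤ) : (C.dest d p).1 = p.1 := by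
  unfold dest
  cases d <;> first | exact (hd trivial).elim | (split_ifs <;> simp [Dir.vec])

theorem dest_fst_lt (hd : d.IsHorizontal) (hp : p ∈ C.full) (hq : q ∈ C.full) (h : p.2 = q.2)
    (hlt : p.1 < q.1) : (C.dest d p).1 < (C.dest d q).1 := by
  have hne : (C.dest d p).1 ≠ (C.dest d q).1 := fun h' => hlt.ne <| congrArg Prod.fst <|
    C.dest_injOn d hp hq <| Prod.ext h' <| by rw [dest_snd hd, dest_snd hd, h]
  refine lt_of_le_of_ne ?_ hne
  cases d
  case up => exact hd.elim
  case down => exact hd.elim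
  all_goals
    unfold dest
    split_ifs <;> (try simp only [Dir.vec, Prod.fst_add]) <;> omega

theorem dest_snd_lt (hd : ¬d.IsHorizontal) (hp : p ∈ C.full) (hq : q ∈ C.full) (h : p.1 = q.1)
    (hlt : p.2 < q.2) : (C.dest d p).2 < (C.dest d q).2 := by
  have hne : (C.dest d p).2 ≠ (C.dest d q).2 := fun h' => hlt.ne <| congrArg Prod.snd <|
    C.dest_injOn d hp hq <| Prod.ext (by rw [dest_fst hd, dest_fst hd, h]) h'
  refine lt_of_le_of_ne ?_ hne
  cases d
  case left => exact (hd trivial).elim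
  case right => exact (hd trivial).elim
  all_goals
    unfold dest
    split_ifs <;> (try simp only [Dir.vec, Prod.snd_add]) <;> omega

/-- Tokens stay in their rows and cannot pass each other there. Strict monotonicity on a linear
order yields both directions. -/
theorem rowKey_dest_lt_iff (hd : d.IsHorizontal) (hp : p ∈ C.full) (hq : q ∈ C.full) :
    rowKey (C.dest d p) < rowKey (C.dest d q) ↔ rowKey p < rowKey q := by
  have : StrictMonoOn (fun a : ℤ ×ₗ ℤ => rowKey (C.dest d ((ofLex a).2, (ofLex a).1)))
      (rowKey '' C.full) := by
    rintro _ ⟨a, ha, rfl⟩ _ ⟨b, hb, rfl⟩ hab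
    rw [rowKey_lt] at hab
    refine rowKey_lt.2 ?_
    simp only [dest_snd hd]
    exact hab.imp id fun h => ⟨h.1, dest_fst_lt hd ha hb h.1 h.2⟩
  exact this.lt_iff_lt ⟨p, hp, rfl⟩ ⟨q, hq, rfl⟩

theorem colKey_dest_lt_iff (hd : ¬d.IsHorizontal) (hp : p ∈ C.full) (hq : q ∈ C.full) :
    colKey (C.dest d p) < colKey (C.dest d q) ↔ colKey p < colKey q := by
  have : StrictMonoOn (fun a : ℤ ×ₗ ℤ => colKey (C.dest d (ofLex a))) (colKey '' C.full) := by
    rintro _ ⟨a, ha, rfl⟩ _ ⟨b, hb, rfl⟩ hab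
    rw [colKey_lt] at hab
    refine colKey_lt.2 ?_
    simp only [dest_fst hd]
    exact hab.imp id fun h => ⟨h.1, dest_snd_lt hd ha hb h.1 h.2⟩
  exact this.lt_iff_lt ⟨p, hp, rfl⟩ ⟨q, hq, rfl⟩

end Dest

section Places

variable {T : Type*} {D : Config T} {f : T → ℤ × ℤ}

/-- Every token `t` occurs exactly once in `D`, at the place `f t`. -/
def Places (D : Config T) (f : T → ℤ × ℤ) : Prop := ∀ p t, D.cell p = some t ↔ f t = p

namespace Places

theorem injective (h : D.Places f) : Function.Injective f := fun t u htu =>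
  Option.some.inj (((h _ t).2 rfl).symm.trans ((h _ u).2 htu.symm))

theorem full_eq (h : D.Places f) : D.full = Set.range f := by
  ext p
  simp only [full, Set.mem_ofPred_eq, Option.ne_none_iff_exists', h p, Set.mem_range]

theorem mem_full (h : D.Places f) (t : T) : f t ∈ D.full := h.full_eq ▸ Set.mem_range_self t

theorem push (h : D.Places f) (d : Dir) : (D.push d).Places fun t => D.dest d (f t) := by
  intro q t
  rw [dest_eq_iff (h.mem_full t)]
  simp only [Config.push]
  split_ifs with h1 h2
  · simpa [h1] using h _ t
  · simp [h1, h2]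
  · simpa [h1, h2] using h _ t

variable [Fintype T]

theorem coe_image (h : D.Places f) : (univ.image f : Set (ℤ × ℤ)) = D.full := by
  simp [h.full_eq]

theorem mem_image (h : D.Places f) (p : ℤ × ℤ) : p ∈ univ.image f ↔ p ∈ D.full := by
  rw [← h.coe_image, Finset.mem_coe]

variable [LinearOrder T]

/-- Horizontally, both summands are unchanged. Vertically, row inversions equal `crossings` minus
column inversions; the latter are unchanged, and `crossings + lengthParity` survives the permutation
of the rows. -/
theorem inversions_add_lengthParity_push (h : D.Places f) (hD : Nested D.full) (d : Dir) :
    inversions rowKey (fun t => D.dest d (f t)) +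
      lengthParity (univ.image fun t => D.dest d (f t)) =
    inversions rowKey f + lengthParity (univ.image f) := by
  have hf := h.injective
  have hg := (h.push d).injective
  by_cases hd : d.IsHorizontal
  · congr 1
    · exact inversions_congr fun t u => rowKey_dest_lt_iff hd (h.mem_full t) (h.mem_full u)
    · exact lengthParity_image_eq hf hg 1 0 fun t => by simp [dest_snd hd]
  · have hcol : inversions colKey (fun t => D.dest d (f t)) = inversions colKey f :=
      inversions_congr fun t u => colKey_dest_lt_iff hd (h.mem_full t) (h.mem_full u)
    obtain ⟨σ, hσ⟩ := exists_perm_full_push hD d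
    have hperm := crossings_add_lengthParity_of_perm (A := univ.image f)
      (B := univ.image fun t => D.dest d (f t)) (by rwa [h.coe_image]) σ fun q => by
        rw [(h.push d).mem_image, h.mem_image, hσ]
        cases d <;> first | exact (hd trivial).elim | rfl
    have h1 := inversions_row_add_col hf
    have h2 := inversions_row_add_col hg
    linear_combination hperm + h2 - h1 - hcol

theorem exists_places_pushes (h : D.Places f) (hD : Nested D.full) (ds : List Dir) :
    ∃ g, (D.pushes ds).Places g ∧ inversions rowKey g + lengthParity (univ.image g) =
      inversions rowKey f + lengthParity (univ.image f) := by
  induction ds generalizing D f with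
  | nil => exact ⟨f, h, rfl⟩
  | cons d ds ih =>
    obtain ⟨g, hg, hgf⟩ := ih (h.push d) (nested_full_push hD d)
    exact ⟨g, hg, hgf.trans (h.inversions_add_lengthParity_push hD d)⟩

end Places

end Places

/-- A sequence of pushes that permutes the tokens of a nested configuration, up to translation,
permutes them evenly. -/
theorem Places.sign_eq_one {T : Type*} [Fintype T] [DecidableEq T] {D : Config T}
    {f : T → ℤ × ℤ} (h : D.Places f) (hD : Nested D.full) (π : Equiv.Perm T) (ds : List Dir)
    (v : ℤ × ℤ) (hπ : ∀ t, (D.pushes ds).cell (f (π t) + v) = some t) : π.sign = 1 := by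
  -- With this order the initial placement has no inversions, and those of the final placement are
  -- exactly those of `π`.
  let _ : LinearOrder T := LinearOrder.lift' (fun t => rowKey (f t))
    (rowKey_injective.comp h.injective)
  have hlt : ∀ t u, t < u ↔ rowKey (f t) < rowKey (f u) := fun t u => Iff.rfl
  obtain ⟨g, hg, hgf⟩ := h.exists_places_pushes hD ds
  have hgπ : ∀ t, g t = f (π t) + v := fun t => (hg _ t).1 (hπ t)
  rw [lengthParity_image_eq h.injective hg.injective π v.2 fun t => by simp [hgπ],
    add_left_inj] at hgf
  refine Equiv.Perm.sign_eq_one_of_inversions π ?_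
  have hf0 : inversions rowKey f = 0 :=
    Finset.sum_eq_zero fun t _ => Finset.sum_eq_zero fun u _ =>
      if_neg fun htu => lt_asymm ((hlt t u).1 htu.1) htu.2
  refine Eq.trans ?_ (hgf.trans hf0)
  refine Finset.sum_congr rfl fun t _ => Finset.sum_congr rfl fun u _ => ?_
  have : rowKey (g u) < rowKey (g t) ↔ π u < π t := by
    rw [hlt, hgπ, hgπ, rowKey_lt, rowKey_lt]
    simp
  simp only [this]

theorem places_tracked {S : Type*} (C : Config S) :
    C.tracked.Places (Subtype.val : C.Token → ℤ × ℤ) := by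
  rintro p ⟨t, ht⟩
  simp only [tracked]
  split_ifs with h
  · simp [eq_comm]
  · simp only [false_iff]
    rintro rfl
    exact h ht

end Config

end PushPuzzle

theorem theorem4p3 {S : Type*} (C : PushPuzzle.Config S) (hC : C.IsCanonical)
    (π : Equiv.Perm C.Token) (hπ : π ∈ C.permGroup) :
    Equiv.Perm.sign π = 1 := by
  obtain ⟨ds, v, -, hv⟩ := hπ
  have h := C.places_tracked
  refine h.sign_eq_one ?_ π ds v hv
  rw [h.full_eq, Subtype.range_coe_subtype]
  exact hC.nested_full
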